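/- Consider a market with $M\ge 1$ consumers and $N$ firms, an inelastic demand $d_0>0$ per consumer and a capacity $\kappa_0>0$ per firm, where $Md_0<N\kappa_0$. Assumption 1. For each consumer $i$, $U_i$ is concave, strictly increasing and continuously differentiable on $[d_0,\infty)$ with $U_i(d_0)=0$. For each firm $j$, $C_j:\mathbb{R}\to\mathbb{R}$ is convex, strictly increasing, continuously differentiable (one-sidedly at $0$) and nonnegative on $[0,\infty)$, and $C_j(s)=0$ for $s\le 0$. Assumption 2. No firm is pivotal: $\dfrac{(N-1)\kappa_0}{Md_0}>1$. In the game $\mathcal{G}$ consumer $i$ chooses $\theta_d^i\ge 0$ and firm $j$ chooses $\theta_s^j\ge 0$. With $$p=p(\theta_d,\theta_s)=\frac{\sum_{i}\theta_d^i+\sum_{j}\theta_s^j}{N\kappa_0-Md_0},\qquad D(\theta,p)=d_0+\frac{\theta}{p},\qquad S(\theta,p)=\kappa_0-\frac{\theta}{p}$$ (and $D(0,0)=d_0$, $S(0,0)=\kappa_0$), the payoff of consumer $i$ is $U_i(D(\theta_d^i,p))-p\,d_0-\theta_d^i$, and the payoff of firm $j$ is $p\,\kappa_0-\theta_s^j-C_j(S(\theta_s^j,p))$.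 A Nash equilibrium is a profile of nonnegative $\theta_d^i,\theta_s^j$ from which no player gains by a unilateral deviation to another nonnegative number. Let $$\tilde U_i(d)=\Bigl(1-\frac{d}{N\kappa_0-(M-1)d_0}\Bigr)U_i(d)+\frac{1}{N\kappa_0-(M-1)d_0}\int_{d_0}^{d}U_i(z)\,dz,$$ $$\tilde C_j(s)=\Bigl(1+\frac{s}{(N-1)\kappa_0-Md_0}\Bigr)C_j(s)-\frac{1}{(N-1)\kappa_0-Md_0}\int_0^{s}C_j(z)\,dz .$$ Theorem. Suppose Assumptions 1 and 2 hold. Then $\mathcal{G}$ has a Nash equilibrium. It is unique if every $C_j$ is continuously differentiable on all of $\mathbb{R}$ (so that also $C_j'(0)=0$), and also, without this condition, if $Md_0$ is not an integer multiple of $\kappa_0$. Moreover, the program $$\text{maximize } \sum_{i=1}^M\tilde U_i(d_i)-\sum_{j=1}^N\tilde C_j(s_j)\quad\text{subject to } \sum_i d_i=\sum_j s_j,\quad 0\le s_j\le\kappa_0\ \ \forall j,\quad d_i\ge d_0\ \ \forall i$$ is convex (its feasible set is convex and its objective is concave there) and has a unique solution $(\tilde d,\tilde s)$; and at every Nash equilibrium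 $(\tilde\theta_d,\tilde\theta_s)$ the price $p=p(\tilde\theta_d,\tilde\theta_s)$ is positive and $\tilde d_i=D(\tilde\theta_d^i,p)$, $\tilde s_j=S(\tilde\theta_s^j,p)$ for all $i,j$. -/

import Mathlib

/-- The data of a two-sided market with `M` consumers and `N` firms: the inelastic demand `d₀`
of each consumer, the capacity `κ₀` of each firm, the utilities `U i` (relevant on `[d₀, ∞)`
only) and the costs `C i`. -/
structure Market (M N : ℕ) where
  d₀ : ℝ
  κ₀ : ℝ
  U : Fin M → ℝ → ℝ
  C : Fin N → ℝ → ℝ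

namespace Market

variable {M N : ℕ}

/-- Concave utilities on `[d₀, ∞)`, convex costs on `[0, ∞)` that vanish on `(-∞, 0]`.
Continuous differentiability is one-sided at the end points `d₀` and `0`. -/
structure ConcaveUtilitiesConvexCosts (m : Market M N) : Prop where
  utility_concave : ∀ i, ConcaveOn ℝ (Set.Ici m.d₀) (m.U i)
  utility_strictMono : ∀ i, StrictMonoOn (m.U i) (Set.Ici m.d₀)
  utility_contDiff : ∀ i, ContDiffOn ℝ 1 (m.U i) (Set.Ici m.d₀)
  utility_d₀ : ∀ i, m.U i m.d₀ = 0
  cost_convex : ∀ i, ConvexOn ℝ (Set.Ici 0) (m.C i)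
  cost_strictMono : ∀ i, StrictMonoOn (m.C i) (Set.Ici 0)
  cost_contDiff : ∀ i, ContDiffOn ℝ 1 (m.C i) (Set.Ici 0)
  cost_nonneg : ∀ i, ∀ s, 0 ≤ s → 0 ≤ m.C i s
  cost_nonpos : ∀ i, ∀ s, s ≤ 0 → m.C i s = 0

/-- The residual supply index of a firm (all firms have the same capacity). -/
noncomputable def rsi (m : Market M N) (_i : Fin N) : ℝ :=
  (((N : ℝ) - 1) * m.κ₀) / ((M : ℝ) * m.d₀)

/-- No firm is pivotal: every residual supply index exceeds one. -/
def NoPivotalSupplier (m : Market M N) : Prop :=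
  ∀ i : Fin N, 1 < m.rsi i

/-- The demand bid `D(θ, p) = d₀ + θ / p`. Since `0 / 0 = 0` in Lean, this includes the
convention `D(0, 0) = d₀`. -/
noncomputable def demandBid (m : Market M N) (θ p : ℝ) : ℝ :=
  m.d₀ + θ / p

/-- The supply offer `S(θ, p) = κ₀ - θ / p`, with `S(0, 0) = κ₀`. -/
noncomputable def supplyOffer (m : Market M N) (θ p : ℝ) : ℝ :=
  m.κ₀ - θ / p

/-- The market price for the bids `θ.1` of the consumers and the offers `θ.2` of the firms. It
is zero if all of these are zero. -/
noncomputable def price (m : Market M N) (θ : (Fin M → ℝ) × (Fin N → ℝ)) : ℝ :=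
  (∑ i, θ.1 i + ∑ j, θ.2 j) / ((N : ℝ) * m.κ₀ - (M : ℝ) * m.d₀)

/-- The payoff of a price-anticipating consumer. -/
noncomputable def consumerPayoff (m : Market M N) (i : Fin M)
    (θ : (Fin M → ℝ) × (Fin N → ℝ)) : ℝ :=
  m.U i (m.demandBid (θ.1 i) (m.price θ)) - m.price θ * m.d₀ - θ.1 i

/-- The payoff of a price-anticipating firm. -/
noncomputable def firmPayoff (m : Market M N) (j : Fin N)
    (θ : (Fin M → ℝ) × (Fin N → ℝ)) : ℝ :=
  m.price θ * m.κ₀ - θ.2 j - m.C j (m.supplyOffer (θ.2 j) (m.price θ))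

/-- Nash equilibria of the game in which every consumer and every firm chooses a nonnegative
real number. -/
structure IsNashEquilibrium (m : Market M N) (θ : (Fin M → ℝ) × (Fin N → ℝ)) : Prop where
  consumer_nonneg : ∀ i, 0 ≤ θ.1 i
  firm_nonneg : ∀ j, 0 ≤ θ.2 j
  consumer_best : ∀ i, ∀ t : ℝ, 0 ≤ t →
    m.consumerPayoff i (Function.update θ.1 i t, θ.2) ≤ m.consumerPayoff i θ
  firm_best : ∀ j, ∀ t : ℝ, 0 ≤ t →
    m.firmPayoff j (θ.1, Function.update θ.2 j t) ≤ m.firmPayoff j θ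

/-- The demand and supply profiles that result from the bids and offers `θ`. -/
noncomputable def allocation (m : Market M N) (θ : (Fin M → ℝ) × (Fin N → ℝ)) :
    (Fin M → ℝ) × (Fin N → ℝ) :=
  (fun i => m.demandBid (θ.1 i) (m.price θ), fun j => m.supplyOffer (θ.2 j) (m.price θ))

/-- The modified utility `Ũ i`. -/
noncomputable def modifiedUtility (m : Market M N) (i : Fin M) (d : ℝ) : ℝ :=
  (1 - d / ((N : ℝ) * m.κ₀ - ((M : ℝ) - 1) * m.d₀)) * m.U i d
    + 1 / ((N : ℝ) * m.κ₀ - ((M : ℝ) - 1) * m.d₀) * ∫ z in m.d₀..d, m.U i z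

/-- The modified cost `C̃ j`. -/
noncomputable def modifiedCost (m : Market M N) (j : Fin N) (s : ℝ) : ℝ :=
  (1 + s / (((N : ℝ) - 1) * m.κ₀ - (M : ℝ) * m.d₀)) * m.C j s
    - 1 / (((N : ℝ) - 1) * m.κ₀ - (M : ℝ) * m.d₀) * ∫ z in (0 : ℝ)..s, m.C j z

/-- The feasible allocations `(d, s)`. -/
def feasible (m : Market M N) : Set ((Fin M → ℝ) × (Fin N → ℝ)) :=
  {x | ∑ i, x.1 i = ∑ j, x.2 j ∧ (∀ j, 0 ≤ x.2 j ∧ x.2 j ≤ m.κ₀) ∧ ∀ i, m.d₀ ≤ x.1 i}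

/-- The objective of the modified welfare maximization program. -/
noncomputable def modifiedWelfare (m : Market M N) (x : (Fin M → ℝ) × (Fin N → ℝ)) : ℝ :=
  ∑ i, m.modifiedUtility i (x.1 i) - ∑ j, m.modifiedCost j (x.2 j)

/-- `x` solves the modified welfare maximization program. -/
def SolvesModifiedProgram (m : Market M N) (x : (Fin M → ℝ) × (Fin N → ℝ)) : Prop :=
  x ∈ m.feasible ∧ IsMaxOn m.modifiedWelfare m.feasible x

end Market

open Set Filter Topology in
theorem IsMaxOn.mul_sub_nonpos {f : ℝ → ℝ} {f' x y : ℝ} {S : Set ℝ} (hS : Convex ℝ S)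
    (hmax : IsMaxOn f S x) (hf : HasDerivWithinAt f f' S x) (hx : x ∈ S) (hy : y ∈ S) :
    f' * (y - x) ≤ 0 := by
  have h := (IsMaxOn.localize hmax).hasFDerivWithinAt_nonpos hf.hasFDerivWithinAt
    (sub_mem_posTangentConeAt_of_segment_subset (hS.segment_subset hx hy))
  simpa [mul_comm] using h

theorem ConcaveOn.le_add_mul_sub {f : ℝ → ℝ} {f' x y : ℝ} {S : Set ℝ} (hc : ConcaveOn ℝ S f)
    (hf : HasDerivWithinAt f f' S x) (hx : x ∈ S) (hy : y ∈ S) :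
    f y ≤ f x + f' * (y - x) := by
  rcases lt_trichotomy x y with h | rfl | h
  · have := hc.slope_le_of_hasDerivWithinAt hx hy h hf
    rw [slope_def_field, div_le_iff₀ (sub_pos.2 h)] at this
    linarith
  · simp
  · have := hc.le_slope_of_hasDerivWithinAt hy hx h hf
    rw [slope_def_field, le_div_iff₀ (sub_pos.2 h)] at this
    linarith

/-- Optimality of a separable sum under pairwise transfers: a maximizer of `∑ k, f k (x k)` with
`∑ k, x k` fixed is supported by a common multiplier. -/
theorem exists_multiplier_of_isMax {ι : Type*} [Fintype ι] [DecidableEq ι] {S : ι → Set ℝ}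
    (hS : ∀ k, Convex ℝ (S k)) {f : ι → ℝ → ℝ} {g x : ι → ℝ} (hx : ∀ k, x k ∈ S k)
    (hf : ∀ k, HasDerivWithinAt (f k) (g k) (S k) (x k))
    (hmax : ∀ z : ι → ℝ, (∀ k, z k ∈ S k) → ∑ k, z k = ∑ k, x k →
      ∑ k, f k (z k) ≤ ∑ k, f k (x k))
    (hup : ∃ k, ∃ y ∈ S k, x k < y) :
    ∃ p, ∀ k, ∀ y ∈ S k, (g k - p) * (y - x k) ≤ 0 := by
  classical
  have exchange : ∀ k l y z, y ∈ S k → x k < y → z ∈ S l → z < x l → g k ≤ g l := by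
    intro k l y z hy hky hz hzl
    rcases eq_or_ne k l with rfl | hkl
    · exact le_rfl
    set δ := min (y - x k) (x l - z) with hδ
    have hδ0 : 0 < δ := lt_min (by linarith) (by linarith)
    have hδ1 : δ ≤ y - x k := min_le_left _ _
    have hδ2 : δ ≤ x l - z := min_le_right _ _
    have hk : ∀ t ∈ Set.Icc 0 δ, x k + t ∈ S k := fun t ht =>
      (hS k).ordConnected.out (hx k) hy ⟨by linarith [ht.1], by linarith [ht.2]⟩
    have hl : ∀ t ∈ Set.Icc 0 δ, x l - t ∈ S l := fun t ht =>
      (hS l).ordConnected.out hz (hx l) ⟨by linarith [ht.2], by linarith [ht.1]⟩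
    have hM : IsMaxOn (fun t => f k (x k + t) + f l (x l - t)) (Set.Icc 0 δ) 0 := by
      intro t ht
      set z' : ι → ℝ := fun i => if i = k then x k + t else if i = l then x l - t else x i with hz'
      have hzk : z' k = x k + t := by simp [hz']
      have hzl : z' l = x l - t := by simp [hz', hkl.symm]
      have hzi : ∀ i, i ≠ k ∧ i ≠ l → z' i = x i := fun i hi => by simp [hz', hi.1, hi.2]
      have h1 : ∑ i, (z' i - x i) = (z' k - x k) + (z' l - x l) :=
        Fintype.sum_eq_add k l hkl fun i hi => by rw [hzi i hi, sub_self]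
      have h2 : ∑ i, (f i (z' i) - f i (x i)) =
          (f k (z' k) - f k (x k)) + (f l (z' l) - f l (x l)) :=
        Fintype.sum_eq_add k l hkl fun i hi => by rw [hzi i hi, sub_self]
      rw [Finset.sum_sub_distrib, hzk, hzl] at h1 h2
      have h3 := hmax z' (fun i => by
        by_cases hik : i = k
        · subst hik; rw [hzk]; exact hk t ht
        by_cases hil : i = l
        · subst hil; rw [hzl]; exact hl t ht
        rw [hzi i ⟨hik, hil⟩]; exact hx i) (by linarith)
      simp only [Set.mem_ofPred_eq, add_zero, sub_zero]
      linarith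
    have hd : HasDerivWithinAt (fun t => f k (x k + t) + f l (x l - t)) (g k - g l)
        (Set.Icc 0 δ) 0 := by
      have h1 : HasDerivWithinAt (fun t => f k (x k + t)) (g k * 1) (Set.Icc 0 δ) 0 :=
        HasDerivWithinAt.comp (s' := S k) 0 (by simpa using hf k)
          ((hasDerivWithinAt_id _ _).const_add (x k)) hk
      have h2 : HasDerivWithinAt (fun t => f l (x l - t)) (g l * (-1)) (Set.Icc 0 δ) 0 :=
        HasDerivWithinAt.comp (s' := S l) 0 (by simpa using hf l)
          ((hasDerivWithinAt_id _ _).const_sub (x l)) hl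
      exact (h1.add h2).congr_deriv (by ring)
    have := hM.mul_sub_nonpos (convex_Icc 0 δ) hd ⟨le_rfl, hδ0.le⟩ ⟨hδ0.le, le_rfl⟩
    rw [sub_zero] at this
    nlinarith
  set A : Finset ι := {k | ∃ y ∈ S k, x k < y} with hA
  have hAne : A.Nonempty := by
    obtain ⟨k, hk⟩ := hup
    exact ⟨k, by simpa [hA] using hk⟩
  obtain ⟨k₀, hk₀, hk₀max⟩ := A.exists_max_image g hAne
  obtain ⟨y₀, hy₀, hxy₀⟩ : ∃ y ∈ S k₀, x k₀ < y := by simpa [hA] using hk₀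
  refine ⟨g k₀, fun k y hy => ?_⟩
  rcases lt_trichotomy (x k) y with h | h | h
  · have := hk₀max k (by simpa [hA] using ⟨y, hy, h⟩)
    nlinarith
  · simp [h]
  · have := exchange k₀ k y₀ y hy₀ hxy₀ hy h
    nlinarith

/-- The criterion `f y - a * y / (K - y)` of a price-anticipating player is maximal at `x` if and
only if the marginal value `(1 - x / K) * f' x` is supported by the price `a / (K - x)`. -/
theorem isMaxOn_sub_mul_div_iff {f : ℝ → ℝ} {f' x a K : ℝ} {S : Set ℝ} (hc : ConcaveOn ℝ S f)
    (hf : HasDerivWithinAt f f' S x) (hx : x ∈ S) (ha : 0 < a)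
    (hK : ∀ y ∈ S, 0 < K * (K - y)) :
    IsMaxOn (fun y => f y - a * y / (K - y)) S x ↔
      ∀ y ∈ S, ((1 - x / K) * f' - a / (K - x)) * (y - x) ≤ 0 := by
  have hK0 : K ≠ 0 := fun h => by simpa [h] using hK x hx
  have hne : ∀ y ∈ S, K - y ≠ 0 := fun y hy h => by simpa [h] using hK y hy
  have hfac : 0 < K / (K - x) := by
    have := hK x hx
    rcases pos_and_pos_or_neg_and_neg_of_mul_pos this with h | h
    · exact div_pos h.1 h.2
    · exact div_pos_of_neg_of_neg h.1 h.2
  have hxne := hne x hx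
  have key : f' - a * K / (K - x) ^ 2 = K / (K - x) * ((1 - x / K) * f' - a / (K - x)) := by
    field_simp
  have hd : HasDerivWithinAt (fun y => f y - a * y / (K - y))
      (f' - a * K / (K - x) ^ 2) S x := by
    have h1 : HasDerivWithinAt (fun y : ℝ => a * y) (a * 1) S x :=
      (hasDerivWithinAt_id x S).const_mul a
    have h2 : HasDerivWithinAt (fun y : ℝ => K - y) (-1) S x :=
      (hasDerivWithinAt_id x S).const_sub K
    refine (hf.sub (h1.div h2 hxne)).congr_deriv ?_
    ring
  constructor
  · intro hmax y hy
    have := hmax.mul_sub_nonpos hc.1 hd hx hy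
    rw [key, mul_assoc] at this
    exact nonpos_of_mul_nonpos_right this hfac
  · intro h y hy
    have h1 := hc.le_add_mul_sub hf hx hy
    have h2 := mul_nonpos_of_nonneg_of_nonpos hfac.le (h y hy)
    rw [← mul_assoc, ← key] at h2
    have hyne := hne y hy
    have hfac' : 0 < K / (K - y) := by
      rcases pos_and_pos_or_neg_and_neg_of_mul_pos (hK y hy) with h | h
      · exact div_pos h.1 h.2
      · exact div_pos_of_neg_of_neg h.1 h.2
    have h3 : a * y / (K - y) - a * x / (K - x) - a * K / (K - x) ^ 2 * (y - x)
        = a * (K / (K - y)) * ((y - x) / (K - x)) ^ 2 := by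
      field_simp
      ring
    have h4 : 0 ≤ a * (K / (K - y)) * ((y - x) / (K - x)) ^ 2 := by positivity
    simp only [Set.mem_ofPred_eq]
    linarith

theorem hasDerivWithinAt_modified {f : ℝ → ℝ} {f' a K x : ℝ}
    (hc : ContinuousOn f (Set.Ici a)) (hx : a ≤ x) (hf : HasDerivWithinAt f f' (Set.Ici a) x) :
    HasDerivWithinAt (fun d => (1 - d / K) * f d + 1 / K * ∫ z in a..d, f z)
      ((1 - x / K) * f') (Set.Ici a) x := by
  set F : ℝ → ℝ := fun z => f (max a z) with hF
  have hFc : Continuous F :=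
    hc.comp_continuous (continuous_const.max continuous_id) fun z => Set.mem_Ici.2 (le_max_left _ _)
  have hint : HasDerivWithinAt (fun d => ∫ z in a..d, f z) (f x) (Set.Ici a) x := by
    have h1 : HasDerivAt (fun d => ∫ z in a..d, F z) (F x) x :=
      intervalIntegral.integral_hasDerivAt_right (hFc.intervalIntegrable _ _)
        hFc.aestronglyMeasurable.stronglyMeasurableAtFilter hFc.continuousAt
    have hFx : F x = f x := by simp [hF, hx]
    rw [hFx] at h1
    have heq : ∀ d ∈ Set.Ici a, ∫ z in a..d, f z = ∫ z in a..d, F z := by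
      intro d hd
      refine intervalIntegral.integral_congr fun z hz => ?_
      rw [Set.uIcc_of_le hd] at hz
      simp [hF, hz.1]
    exact h1.hasDerivWithinAt.congr heq (heq x hx)
  have h2 : HasDerivWithinAt (fun d : ℝ => 1 - d / K) (-(1 / K)) (Set.Ici a) x :=
    ((hasDerivWithinAt_id x _).div_const K).const_sub 1
  refine ((h2.mul hf).add (hint.const_mul (1 / K))).congr_deriv ?_
  ring

theorem strictConcaveOn_sum_pi {ι : Type*} [Fintype ι] {S : ι → Set ℝ} {f : ι → ℝ → ℝ}
    (hf : ∀ k, StrictConcaveOn ℝ (S k) (f k)) :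
    StrictConcaveOn ℝ {x : ι → ℝ | ∀ k, x k ∈ S k} (fun x => ∑ k, f k (x k)) := by
  refine ⟨fun x hx y hy a b ha hb hab k => (hf k).1 (hx k) (hy k) ha hb hab, ?_⟩
  intro x hx y hy hxy a b ha hb hab
  obtain ⟨k, hk⟩ := Function.ne_iff.1 hxy
  simp only [Finset.smul_sum, ← Finset.sum_add_distrib]
  exact Finset.sum_lt_sum
    (fun i _ => (hf i).concaveOn.2 (hx i) (hy i) ha.le hb.le hab)
    ⟨k, Finset.mem_univ k, (hf k).2 (hx k) (hy k) hk ha hb hab⟩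

theorem StrictConcaveOn.prod_add {E F : Type*} [AddCommGroup E] [Module ℝ E] [AddCommGroup F]
    [Module ℝ F] {s : Set E} {t : Set F} {f : E → ℝ} {g : F → ℝ} (hf : StrictConcaveOn ℝ s f)
    (hg : StrictConcaveOn ℝ t g) :
    StrictConcaveOn ℝ (s ×ˢ t) (fun x => f x.1 + g x.2) := by
  refine ⟨hf.1.prod hg.1, ?_⟩
  rintro ⟨x₁, x₂⟩ ⟨hx₁, hx₂⟩ ⟨y₁, y₂⟩ ⟨hy₁, hy₂⟩ hxy a b ha hb hab
  have h1 := hf.concaveOn.2 hx₁ hy₁ ha.le hb.le hab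
  have h2 := hg.concaveOn.2 hx₂ hy₂ ha.le hb.le hab
  simp only [smul_eq_mul, Prod.smul_mk, Prod.mk_add_mk] at h1 h2 ⊢
  by_cases h : x₁ = y₁
  · have h3 := hg.2 hx₂ hy₂ (fun h' => hxy (Prod.ext h h')) ha hb hab
    simp only [smul_eq_mul] at h3
    linarith
  · have h3 := hf.2 hx₁ hy₁ h ha hb hab
    simp only [smul_eq_mul] at h3
    linarith

/-- A function with a one-sided derivative that is strictly decreasing in the interior of an
interval is strictly concave there. -/
theorem strictConcaveOn_of_hasDerivWithinAt {f g : ℝ → ℝ} {S T : Set ℝ} (hS : Convex ℝ S)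
    (hST : S ⊆ T) (hf : ∀ x ∈ S, HasDerivWithinAt f (g x) T x)
    (hg : StrictAntiOn g (interior S)) : StrictConcaveOn ℝ S f := by
  refine StrictAntiOn.strictConcaveOn_of_deriv hS
    (fun x hx => ((hf x hx).mono hST).continuousWithinAt) ?_
  refine hg.congr fun x hx => ?_
  exact (((hf x (interior_subset hx)).mono hST).hasDerivAt (
    mem_interior_iff_mem_nhds.1 hx)).deriv.symm

namespace Market

variable {M N : ℕ} {m : Market M N}

/-- The supremum `N κ₀ - (M - 1) d₀` of the demand which one consumer can obtain. -/
noncomputable def maxDemand (m : Market M N) : ℝ := (N : ℝ) * m.κ₀ - ((M : ℝ) - 1) * m.d₀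

/-- The capacity `(N - 1) κ₀ - M d₀` in excess of demand when one firm is removed. -/
noncomputable def spareCapacity (m : Market M N) : ℝ := ((N : ℝ) - 1) * m.κ₀ - (M : ℝ) * m.d₀

noncomputable def marginalUtility (m : Market M N) (i : Fin M) (d : ℝ) : ℝ :=
  derivWithin (m.U i) (Set.Ici m.d₀) d

noncomputable def marginalCost (m : Market M N) (j : Fin N) (s : ℝ) : ℝ :=
  derivWithin (m.C j) (Set.Ici 0) s

/-- The allocation `x` is feasible and satisfies the first order conditions of the modified
program with the multiplier `p`. -/
structure IsSupportedBy (m : Market M N) (x : (Fin M → ℝ) × (Fin N → ℝ)) (p : ℝ) : Prop where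
  feasible : x ∈ m.feasible
  consumer : ∀ i, ∀ y, m.d₀ ≤ y →
    ((1 - x.1 i / m.maxDemand) * m.marginalUtility i (x.1 i) - p) * (y - x.1 i) ≤ 0
  firm : ∀ j, ∀ y, 0 ≤ y → y ≤ m.κ₀ →
    (p - (1 + x.2 j / m.spareCapacity) * m.marginalCost j (x.2 j)) * (y - x.2 j) ≤ 0

theorem firms_pos (hd₀ : 0 < m.d₀) (hcap : (M : ℝ) * m.d₀ < (N : ℝ) * m.κ₀) : 0 < N := by
  rcases Nat.eq_zero_or_pos N with rfl | h
  · have : 0 ≤ (M : ℝ) * m.d₀ := by positivity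
    simp only [Nat.cast_zero, zero_mul] at hcap
    linarith
  · exact h

theorem spareCapacity_pos (hM : 0 < M) (hd₀ : 0 < m.d₀)
    (hcap : (M : ℝ) * m.d₀ < (N : ℝ) * m.κ₀) (h2 : m.NoPivotalSupplier) :
    0 < m.spareCapacity := by
  have h := h2 ⟨0, firms_pos hd₀ hcap⟩
  have hMd : 0 < (M : ℝ) * m.d₀ := by positivity
  rw [rsi, one_lt_div hMd] at h
  rw [spareCapacity]
  linarith

theorem maxDemand_eq : m.maxDemand = (N : ℝ) * m.κ₀ - (M : ℝ) * m.d₀ + m.d₀ := by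
  rw [maxDemand]; ring

theorem spareCapacity_eq : m.spareCapacity = (N : ℝ) * m.κ₀ - (M : ℝ) * m.d₀ - m.κ₀ := by
  rw [spareCapacity]; ring

theorem d₀_lt_maxDemand (hcap : (M : ℝ) * m.d₀ < (N : ℝ) * m.κ₀) : m.d₀ < m.maxDemand := by
  rw [maxDemand_eq]; linarith

theorem demand_le_maxDemand {x : (Fin M → ℝ) × (Fin N → ℝ)} (hx : x ∈ m.feasible) (i : Fin M) :
    x.1 i ≤ m.maxDemand := by
  obtain ⟨hsum, hs, hd⟩ := hx
  have h1 : ∑ j, x.2 j ≤ (N : ℝ) * m.κ₀ := by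
    calc ∑ j, x.2 j ≤ ∑ _j : Fin N, m.κ₀ := Finset.sum_le_sum fun j _ => (hs j).2
      _ = _ := by simp
  have h2 : x.1 i - m.d₀ ≤ ∑ k, (x.1 k - m.d₀) :=
    Finset.single_le_sum (f := fun k => x.1 k - m.d₀) (fun k _ => sub_nonneg.2 (hd k))
      (Finset.mem_univ i)
  rw [Finset.sum_sub_distrib] at h2
  simp only [Finset.sum_const, Finset.card_univ, Fintype.card_fin, nsmul_eq_mul] at h2
  rw [maxDemand_eq]
  linarith


namespace ConcaveUtilitiesConvexCosts

theorem hasDerivWithinAt_U (h1 : m.ConcaveUtilitiesConvexCosts) (i : Fin M) {d : ℝ}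
    (hd : m.d₀ ≤ d) :
    HasDerivWithinAt (m.U i) (m.marginalUtility i d) (Set.Ici m.d₀) d :=
  ((h1.utility_contDiff i).differentiableOn one_ne_zero d hd).hasDerivWithinAt

theorem hasDerivWithinAt_C (h1 : m.ConcaveUtilitiesConvexCosts) (j : Fin N) {s : ℝ}
    (hs : 0 ≤ s) :
    HasDerivWithinAt (m.C j) (m.marginalCost j s) (Set.Ici 0) s :=
  ((h1.cost_contDiff j).differentiableOn one_ne_zero s hs).hasDerivWithinAt

theorem marginalUtility_antitone (h1 : m.ConcaveUtilitiesConvexCosts) (i : Fin M) :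
    AntitoneOn (m.marginalUtility i) (Set.Ici m.d₀) :=
  (h1.utility_concave i).antitoneOn_derivWithin
    ((h1.utility_contDiff i).differentiableOn one_ne_zero)

theorem marginalCost_monotone (h1 : m.ConcaveUtilitiesConvexCosts) (j : Fin N) :
    MonotoneOn (m.marginalCost j) (Set.Ici 0) :=
  (h1.cost_convex j).monotoneOn_derivWithin ((h1.cost_contDiff j).differentiableOn one_ne_zero)

theorem marginalUtility_pos (h1 : m.ConcaveUtilitiesConvexCosts) (i : Fin M) {d : ℝ}
    (hd : m.d₀ ≤ d) : 0 < m.marginalUtility i d := by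
  have hd' : m.d₀ ≤ d + 1 := by linarith
  have h := (h1.utility_concave i).le_add_mul_sub (h1.hasDerivWithinAt_U i hd) hd hd'
  have := h1.utility_strictMono i hd hd' (lt_add_one d)
  linarith

theorem marginalCost_pos (h1 : m.ConcaveUtilitiesConvexCosts) (j : Fin N) {s : ℝ}
    (hs : 0 < s) : 0 < m.marginalCost j s := by
  have h := (h1.cost_convex j).neg.le_add_mul_sub (h1.hasDerivWithinAt_C j hs.le).neg hs.le
    (Set.self_mem_Ici (a := (0 : ℝ)))
  have := h1.cost_strictMono j Set.self_mem_Ici hs.le hs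
  simp only [Pi.neg_apply] at h
  by_contra! hneg
  nlinarith

theorem hasDerivWithinAt_modifiedUtility (h1 : m.ConcaveUtilitiesConvexCosts) (i : Fin M)
    {d : ℝ} (hd : m.d₀ ≤ d) :
    HasDerivWithinAt (m.modifiedUtility i) ((1 - d / m.maxDemand) * m.marginalUtility i d)
      (Set.Ici m.d₀) d :=
  hasDerivWithinAt_modified (h1.utility_contDiff i).continuousOn hd (h1.hasDerivWithinAt_U i hd)

theorem hasDerivWithinAt_modifiedCost (h1 : m.ConcaveUtilitiesConvexCosts) (j : Fin N)
    {s : ℝ} (hs : 0 ≤ s) :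
    HasDerivWithinAt (m.modifiedCost j) ((1 + s / m.spareCapacity) * m.marginalCost j s)
      (Set.Ici 0) s := by
  have h := hasDerivWithinAt_modified (K := -m.spareCapacity) (h1.cost_contDiff j).continuousOn hs
    (h1.hasDerivWithinAt_C j hs)
  simp only [div_neg, sub_neg_eq_add, neg_mul, ← sub_eq_add_neg] at h
  exact h

theorem strictConcaveOn_modifiedUtility (h1 : m.ConcaveUtilitiesConvexCosts)
    (hd₀ : 0 < m.d₀) (i : Fin M) :
    StrictConcaveOn ℝ (Set.Icc m.d₀ m.maxDemand) (m.modifiedUtility i) := by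
  refine strictConcaveOn_of_hasDerivWithinAt (convex_Icc _ _) Set.Icc_subset_Ici_self
    (fun d hd => h1.hasDerivWithinAt_modifiedUtility i hd.1) ?_
  rw [interior_Icc]
  intro x hx y hy hxy
  have hK : 0 < m.maxDemand := by linarith [hx.1, hx.2]
  have h2 := h1.marginalUtility_antitone i hx.1.le hy.1.le hxy.le
  have h3 := h1.marginalUtility_pos i hx.1.le
  have h4 : y / m.maxDemand ≤ 1 := (div_le_one hK).2 hy.2.le
  have h5 : x / m.maxDemand < y / m.maxDemand := by gcongr
  calc (1 - y / m.maxDemand) * m.marginalUtility i y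
      ≤ (1 - y / m.maxDemand) * m.marginalUtility i x :=
        mul_le_mul_of_nonneg_left h2 (by linarith)
    _ < (1 - x / m.maxDemand) * m.marginalUtility i x :=
        mul_lt_mul_of_pos_right (by linarith) h3

theorem strictConcaveOn_neg_modifiedCost (h1 : m.ConcaveUtilitiesConvexCosts)
    (hL : 0 < m.spareCapacity) (j : Fin N) :
    StrictConcaveOn ℝ (Set.Icc 0 m.κ₀) (fun s => -m.modifiedCost j s) := by
  refine strictConcaveOn_of_hasDerivWithinAt (convex_Icc _ _) Set.Icc_subset_Ici_self
    (fun s hs => (h1.hasDerivWithinAt_modifiedCost j hs.1).neg) ?_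
  rw [interior_Icc]
  intro x hx y hy hxy
  have h2 := h1.marginalCost_monotone j hx.1.le hy.1.le hxy.le
  have h3 := h1.marginalCost_pos j hx.1
  have h5 : x / m.spareCapacity < y / m.spareCapacity := by gcongr
  have h4 : 0 ≤ y / m.spareCapacity := div_nonneg hy.1.le hL.le
  refine neg_lt_neg ?_
  calc (1 + x / m.spareCapacity) * m.marginalCost j x
      < (1 + y / m.spareCapacity) * m.marginalCost j x :=
        mul_lt_mul_of_pos_right (by linarith) h3
    _ ≤ (1 + y / m.spareCapacity) * m.marginalCost j y :=
        mul_le_mul_of_nonneg_left h2 (by linarith)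

end ConcaveUtilitiesConvexCosts

theorem convex_feasible (m : Market M N) : Convex ℝ m.feasible := by
  rintro x ⟨hx1, hx2, hx3⟩ y ⟨hy1, hy2, hy3⟩ a b ha hb hab
  refine ⟨?_, fun j => ?_, fun i => ?_⟩
  · simp only [Prod.fst_add, Prod.snd_add, Prod.smul_fst, Prod.smul_snd, Pi.add_apply,
      Pi.smul_apply, Finset.sum_add_distrib, ← Finset.smul_sum, hx1, hy1]
  · exact convex_Icc 0 m.κ₀ (hx2 j) (hy2 j) ha hb hab
  · exact convex_Ici m.d₀ (hx3 i) (hy3 i) ha hb hab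

theorem strictConcaveOn_modifiedWelfare (h1 : m.ConcaveUtilitiesConvexCosts)
    (hd₀ : 0 < m.d₀) (hL : 0 < m.spareCapacity) :
    StrictConcaveOn ℝ m.feasible m.modifiedWelfare := by
  have h := (strictConcaveOn_sum_pi fun i => h1.strictConcaveOn_modifiedUtility hd₀ i).prod_add
    (strictConcaveOn_sum_pi fun j => h1.strictConcaveOn_neg_modifiedCost hL j)
  have hsub : m.feasible ⊆ {x : Fin M → ℝ | ∀ i, x i ∈ Set.Icc m.d₀ m.maxDemand} ×ˢ
      {x : Fin N → ℝ | ∀ j, x j ∈ Set.Icc 0 m.κ₀} := fun x hx =>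
    ⟨fun i => ⟨hx.2.2 i, demand_le_maxDemand hx i⟩, hx.2.1⟩
  have hW : m.modifiedWelfare = fun x =>
      ∑ i, m.modifiedUtility i (x.1 i) + ∑ j, -m.modifiedCost j (x.2 j) := by
    funext x
    simp [modifiedWelfare, sub_eq_add_neg]
  rw [hW]
  exact h.subset hsub m.convex_feasible

theorem isCompact_feasible (m : Market M N) : IsCompact m.feasible := by
  have hsub : m.feasible ⊆ (Set.univ.pi fun _ => Set.Icc m.d₀ m.maxDemand) ×ˢ
      (Set.univ.pi fun _ => Set.Icc 0 m.κ₀) := fun x hx =>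
    ⟨fun i _ => ⟨hx.2.2 i, demand_le_maxDemand hx i⟩, fun j _ => hx.2.1 j⟩
  refine ((isCompact_univ_pi fun _ => isCompact_Icc).prod
    (isCompact_univ_pi fun _ => isCompact_Icc)).of_isClosed_subset ?_ hsub
  have : m.feasible = {x : (Fin M → ℝ) × (Fin N → ℝ) | ∑ i, x.1 i = ∑ j, x.2 j} ∩
      ({x | ∀ j, 0 ≤ x.2 j ∧ x.2 j ≤ m.κ₀} ∩ {x | ∀ i, m.d₀ ≤ x.1 i}) := rfl
  rw [this]
  refine (isClosed_eq (by fun_prop) (by fun_prop)).inter (IsClosed.inter ?_ ?_)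
  · simp only [Set.ofPred_forall, Set.ofPred_and]
    exact isClosed_iInter fun j => (isClosed_le (by fun_prop) (by fun_prop)).inter
      (isClosed_le (by fun_prop) (by fun_prop))
  · simp only [Set.ofPred_forall]
    exact isClosed_iInter fun i => isClosed_le (by fun_prop) (by fun_prop)

theorem nonempty_feasible (hd₀ : 0 < m.d₀)
    (hcap : (M : ℝ) * m.d₀ < (N : ℝ) * m.κ₀) : m.feasible.Nonempty := by
  have hN : (0 : ℝ) < N := by exact_mod_cast firms_pos hd₀ hcap
  refine ⟨(fun _ => m.d₀, fun _ => M * m.d₀ / N), ?_, fun _ => ⟨by positivity, ?_⟩, fun _ => le_rfl⟩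
  · simp only [Finset.sum_const, Finset.card_univ, Fintype.card_fin, nsmul_eq_mul]
    field_simp
  · rw [div_le_iff₀ hN]; linarith

theorem continuousOn_modifiedWelfare (h1 : m.ConcaveUtilitiesConvexCosts) :
    ContinuousOn m.modifiedWelfare m.feasible := by
  refine (continuousOn_finsetSum _ fun i _ => ?_).sub (continuousOn_finsetSum _ fun j _ => ?_)
  · have h : ContinuousOn (m.modifiedUtility i) (Set.Ici m.d₀) := fun d hd =>
      (h1.hasDerivWithinAt_modifiedUtility i hd).continuousWithinAt
    exact h.comp (f := fun x : (Fin M → ℝ) × (Fin N → ℝ) => x.1 i) (by fun_prop)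
      fun x hx => hx.2.2 i
  · have h : ContinuousOn (m.modifiedCost j) (Set.Ici 0) := fun d hd =>
      (h1.hasDerivWithinAt_modifiedCost j hd).continuousWithinAt
    exact h.comp (f := fun x : (Fin M → ℝ) × (Fin N → ℝ) => x.2 j) (by fun_prop)
      fun x hx => (hx.2.1 j).1

theorem existsUnique_solvesModifiedProgram (hd₀ : 0 < m.d₀)
    (hcap : (M : ℝ) * m.d₀ < (N : ℝ) * m.κ₀) (h1 : m.ConcaveUtilitiesConvexCosts)
    (hL : 0 < m.spareCapacity) : ∃! x, m.SolvesModifiedProgram x := by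
  obtain ⟨x, hx, hmax⟩ := m.isCompact_feasible.exists_isMaxOn
    (nonempty_feasible hd₀ hcap) (continuousOn_modifiedWelfare h1)
  exact ⟨x, ⟨hx, hmax⟩, fun y hy =>
    (strictConcaveOn_modifiedWelfare h1 hd₀ hL).eq_of_isMaxOn hy.2 hmax hy.1 hx⟩

theorem IsSupportedBy.solvesModifiedProgram {x : (Fin M → ℝ) × (Fin N → ℝ)} {p : ℝ}
    (h : m.IsSupportedBy x p) (h1 : m.ConcaveUtilitiesConvexCosts)
    (hd₀ : 0 < m.d₀) (hL : 0 < m.spareCapacity) : m.SolvesModifiedProgram x := by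
  refine ⟨h.feasible, fun y hy => ?_⟩
  have hx := h.feasible
  have hU : ∀ i, m.modifiedUtility i (y.1 i) - m.modifiedUtility i (x.1 i)
      ≤ p * (y.1 i - x.1 i) := fun i => by
    have h2 := (h1.strictConcaveOn_modifiedUtility hd₀ i).concaveOn.le_add_mul_sub
      ((h1.hasDerivWithinAt_modifiedUtility i (hx.2.2 i)).mono Set.Icc_subset_Ici_self)
      ⟨hx.2.2 i, demand_le_maxDemand hx i⟩ ⟨hy.2.2 i, demand_le_maxDemand hy i⟩
    linarith [h.consumer i (y.1 i) (hy.2.2 i)]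
  have hC : ∀ j, p * (y.2 j - x.2 j)
      ≤ m.modifiedCost j (y.2 j) - m.modifiedCost j (x.2 j) := fun j => by
    have h2 := (h1.strictConcaveOn_neg_modifiedCost hL j).concaveOn.le_add_mul_sub
      ((h1.hasDerivWithinAt_modifiedCost j (hx.2.1 j).1).neg.mono Set.Icc_subset_Ici_self)
      (hx.2.1 j) (hy.2.1 j)
    linarith [h.firm j (y.2 j) (hy.2.1 j).1 (hy.2.1 j).2]
  have h2 := Finset.sum_le_sum fun i (_ : i ∈ Finset.univ) => hU i
  have h3 := Finset.sum_le_sum fun j (_ : j ∈ Finset.univ) => hC j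
  simp only [← Finset.mul_sum, Finset.sum_sub_distrib] at h2 h3
  rw [hx.1, hy.1] at h2
  simp only [Set.mem_ofPred_eq, modifiedWelfare]
  linarith

theorem SolvesModifiedProgram.exists_isSupportedBy {x : (Fin M → ℝ) × (Fin N → ℝ)}
    (h : m.SolvesModifiedProgram x) (hM : 0 < M) (h1 : m.ConcaveUtilitiesConvexCosts) :
    ∃ p, m.IsSupportedBy x p := by
  obtain ⟨hx, hmax⟩ := h
  obtain ⟨p, hp⟩ := exists_multiplier_of_isMax
    (S := Sum.elim (fun _ : Fin M => Set.Ici m.d₀) (fun _ : Fin N => Set.Icc (-m.κ₀) 0))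
    (f := Sum.elim m.modifiedUtility (fun j s => -m.modifiedCost j (-s)))
    (g := Sum.elim (fun i => (1 - x.1 i / m.maxDemand) * m.marginalUtility i (x.1 i))
      (fun j => (1 + x.2 j / m.spareCapacity) * m.marginalCost j (x.2 j)))
    (x := Sum.elim x.1 (-x.2))
    (by
      rintro (i | j)
      · exact convex_Ici _
      · exact convex_Icc _ _)
    (by
      rintro (i | j)
      · exact hx.2.2 i
      · exact ⟨neg_le_neg (hx.2.1 j).2, neg_nonpos.2 (hx.2.1 j).1⟩)
    (by
      rintro (i | j)
      · exact h1.hasDerivWithinAt_modifiedUtility i (hx.2.2 i)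
      · have h2 : HasDerivWithinAt (m.modifiedCost j)
            ((1 + x.2 j / m.spareCapacity) * m.marginalCost j (x.2 j)) (Set.Ici 0)
            (-(-x.2 j)) := by
          rw [neg_neg]
          exact h1.hasDerivWithinAt_modifiedCost j (hx.2.1 j).1
        have h3 := HasDerivWithinAt.comp (s' := Set.Ici 0) (-x.2 j) h2
          (hasDerivWithinAt_id (-x.2 j) (Set.Icc (-m.κ₀) 0)).neg
          (fun y hy => neg_nonneg.2 hy.2)
        exact h3.neg.congr_deriv (by simp))
    (by
      intro z hz hsum
      have hy : ((fun i => z (Sum.inl i), fun j => -z (Sum.inr j)) :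
          (Fin M → ℝ) × (Fin N → ℝ)) ∈ m.feasible := by
        refine ⟨?_, fun j => ?_, fun i => hz (Sum.inl i)⟩
        · simp only [Fintype.sum_sum_type, Sum.elim_inl, Sum.elim_inr, Pi.neg_apply,
            Finset.sum_neg_distrib] at hsum ⊢
          linarith [hx.1]
        · have := hz (Sum.inr j)
          exact ⟨neg_nonneg.2 this.2, neg_le.1 this.1⟩
      have := hmax hy
      simpa [modifiedWelfare, Fintype.sum_sum_type, ← sub_eq_add_neg] using this)
    ⟨Sum.inl ⟨0, hM⟩, x.1 ⟨0, hM⟩ + 1, (hx.2.2 _).trans (by linarith), lt_add_one _⟩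
  refine ⟨p, hx, fun i y hy => hp (Sum.inl i) y hy, fun j y hy0 hy1 => ?_⟩
  have := hp (Sum.inr j) (-y) ⟨neg_le_neg hy1, neg_nonpos.2 hy0⟩
  simp only [Sum.elim_inr, Pi.neg_apply] at this
  linarith

namespace IsSupportedBy

theorem price_pos {x : (Fin M → ℝ) × (Fin N → ℝ)} {p : ℝ}
    (h : m.IsSupportedBy x p) (h1 : m.ConcaveUtilitiesConvexCosts) (hM : 0 < M)
    (hd₀ : 0 < m.d₀) (hL : 0 < m.spareCapacity) : 0 < p := by
  have hx := h.feasible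
  have hpos : 0 < ∑ j, x.2 j := by
    rw [← hx.1]
    have : Nonempty (Fin M) := ⟨⟨0, hM⟩⟩
    exact Finset.sum_pos (fun i _ => hd₀.trans_le (hx.2.2 i)) Finset.univ_nonempty
  obtain ⟨j, -, hj⟩ := Finset.exists_lt_of_sum_lt (f := fun _ => (0 : ℝ)) (g := x.2)
    (s := Finset.univ) (by simpa using hpos)
  have h2 := h.firm j 0 le_rfl ((hx.2.1 j).1.trans (hx.2.1 j).2)
  have h3 : 0 < (1 + x.2 j / m.spareCapacity) * m.marginalCost j (x.2 j) := by
    have := h1.marginalCost_pos j hj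
    positivity
  by_contra! hp
  nlinarith

theorem demand_lt_maxDemand {x : (Fin M → ℝ) × (Fin N → ℝ)} {p : ℝ}
    (h : m.IsSupportedBy x p) (hp : 0 < p) (hd₀ : 0 < m.d₀)
    (hcap : (M : ℝ) * m.d₀ < (N : ℝ) * m.κ₀) (i : Fin M) : x.1 i < m.maxDemand := by
  refine (demand_le_maxDemand h.feasible i).lt_of_ne fun heq => ?_
  have hK := d₀_lt_maxDemand hcap
  have h2 := h.consumer i m.d₀ le_rfl
  rw [heq, div_self (hd₀.trans hK).ne'] at h2
  nlinarith

/-- The multiplier is unique unless every consumer and every firm is at a corner. -/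
theorem price_unique {x : (Fin M → ℝ) × (Fin N → ℝ)} {p q : ℝ}
    (hp : m.IsSupportedBy x p) (hq : m.IsSupportedBy x q) (h1 : m.ConcaveUtilitiesConvexCosts)
    (hM : 0 < M) (hd₀ : 0 < m.d₀) (hκ₀ : 0 < m.κ₀) (hL : 0 < m.spareCapacity)
    (hcap : (M : ℝ) * m.d₀ < (N : ℝ) * m.κ₀)
    (hC : (∀ j, ContDiff ℝ 1 (m.C j)) ∨ (∀ k : ℕ, (M : ℝ) * m.d₀ ≠ (k : ℝ) * m.κ₀)) :
    p = q := by
  have hx := hp.feasible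
  by_cases hd : ∃ i, m.d₀ < x.1 i
  · obtain ⟨i, hi⟩ := hd
    have key : ∀ {r}, m.IsSupportedBy x r →
        r = (1 - x.1 i / m.maxDemand) * m.marginalUtility i (x.1 i) := fun {r} hr => by
      have h2 := hr.consumer i m.d₀ le_rfl
      have h3 := hr.consumer i (x.1 i + 1) (by linarith)
      nlinarith
    rw [key hp, key hq]
  by_cases hs : ∃ j, 0 < x.2 j ∧ x.2 j < m.κ₀
  · obtain ⟨j, hj0, hj1⟩ := hs
    have key : ∀ {r}, m.IsSupportedBy x r →
        r = (1 + x.2 j / m.spareCapacity) * m.marginalCost j (x.2 j) := fun {r} hr => by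
      have h2 := hr.firm j 0 le_rfl hκ₀.le
      have h3 := hr.firm j m.κ₀ hκ₀.le le_rfl
      nlinarith
    rw [key hp, key hq]
  exfalso
  push Not at hd hs
  have hdsum : ∑ i, x.1 i = M * m.d₀ := by
    rw [Finset.sum_congr rfl fun i _ => le_antisymm (hd i) (hx.2.2 i)]
    simp
  have hcorner : ∀ j, x.2 j = 0 ∨ x.2 j = m.κ₀ := fun j => by
    rcases (hx.2.1 j).1.eq_or_lt with h | h
    · exact Or.inl h.symm
    · exact Or.inr (le_antisymm (hx.2.1 j).2 (hs j h))
  rcases hC with hC | hC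
  · have hfull : ∀ j, x.2 j = m.κ₀ := fun j => by
      refine (hcorner j).resolve_left fun h0 => ?_
      have hzero : m.marginalCost j 0 = 0 := by
        have hdiff : HasDerivAt (m.C j) (deriv (m.C j) 0) 0 :=
          ((hC j).differentiable one_ne_zero 0).hasDerivAt
        have h2 : HasDerivWithinAt (m.C j) 0 (Set.Iic 0) 0 :=
          (hasDerivWithinAt_const 0 (Set.Iic 0) (0 : ℝ)).congr
            (fun s hs => h1.cost_nonpos j s hs) (h1.cost_nonpos j 0 le_rfl)
        rw [(uniqueDiffWithinAt_Iic (0 : ℝ)).eq_deriv _ hdiff.hasDerivWithinAt h2] at hdiff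
        exact hdiff.hasDerivWithinAt.derivWithin (uniqueDiffWithinAt_Ici 0)
      have h2 := hp.firm j m.κ₀ hκ₀.le le_rfl
      rw [h0, hzero] at h2
      have := hp.price_pos h1 hM hd₀ hL
      nlinarith
    have h2 := hx.1
    rw [hdsum, Finset.sum_congr rfl fun j _ => hfull j] at h2
    simp at h2
    linarith
  · refine hC (Finset.univ.filter fun j => x.2 j = m.κ₀).card ?_
    rw [← hdsum, hx.1, Finset.sum_congr rfl fun j _ =>
      show x.2 j = if x.2 j = m.κ₀ then m.κ₀ else 0 by
        rcases hcorner j with h | h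
        · rw [if_neg (by rw [h]; exact hκ₀.ne)]; exact h
        · rw [if_pos h]; exact h]
    rw [← Finset.sum_filter]
    simp

end IsSupportedBy

/-- The sum of all bids. -/
noncomputable def totalBid (θ : (Fin M → ℝ) × (Fin N → ℝ)) : ℝ := ∑ i, θ.1 i + ∑ j, θ.2 j

theorem totalBid_update_fst (θ : (Fin M → ℝ) × (Fin N → ℝ)) (i : Fin M) (t : ℝ) :
    totalBid (Function.update θ.1 i t, θ.2) = totalBid θ - θ.1 i + t := by
  have h := Finset.sum_update_of_mem (Finset.mem_univ i) θ.1 t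
  have h' := Finset.sum_update_of_mem (Finset.mem_univ i) θ.1 (θ.1 i)
  rw [Function.update_eq_self] at h'
  simp only [totalBid]
  linarith

theorem totalBid_update_snd (θ : (Fin M → ℝ) × (Fin N → ℝ)) (j : Fin N) (t : ℝ) :
    totalBid (θ.1, Function.update θ.2 j t) = totalBid θ - θ.2 j + t := by
  have h := Finset.sum_update_of_mem (Finset.mem_univ j) θ.2 t
  have h' := Finset.sum_update_of_mem (Finset.mem_univ j) θ.2 (θ.2 j)
  rw [Function.update_eq_self] at h'
  simp only [totalBid]
  linarith

theorem price_eq (θ : (Fin M → ℝ) × (Fin N → ℝ)) :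
    m.price θ = totalBid θ / ((N : ℝ) * m.κ₀ - (M : ℝ) * m.d₀) := rfl

/-- The bid with which a consumer obtains the demand `y` when the other bids add up to `a`. -/
theorem consumerPayoff_update {θ : (Fin M → ℝ) × (Fin N → ℝ)} {i : Fin M}
    (hcap : (M : ℝ) * m.d₀ < (N : ℝ) * m.κ₀) (ha : 0 < totalBid θ - θ.1 i) {y : ℝ}
    (hy : y < m.maxDemand) :
    m.consumerPayoff i (Function.update θ.1 i
      ((totalBid θ - θ.1 i) * (y - m.d₀) / (m.maxDemand - y)), θ.2) =
      m.U i y - (totalBid θ - θ.1 i) * y / (m.maxDemand - y) := by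
  set a := totalBid θ - θ.1 i with ha'
  have hR : 0 < (N : ℝ) * m.κ₀ - (M : ℝ) * m.d₀ := sub_pos.2 hcap
  have hy' : 0 < m.maxDemand - y := sub_pos.2 hy
  have hp : m.price (Function.update θ.1 i (a * (y - m.d₀) / (m.maxDemand - y)), θ.2)
      = a / (m.maxDemand - y) := by
    rw [price_eq, totalBid_update_fst, ← ha', div_eq_div_iff hR.ne' hy'.ne', add_mul,
      div_mul_cancel₀ _ hy'.ne', maxDemand_eq]
    ring
  have hD : m.demandBid (a * (y - m.d₀) / (m.maxDemand - y)) (a / (m.maxDemand - y)) = y := by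
    rw [demandBid]
    field_simp
    ring
  simp only [consumerPayoff, hp, Function.update_self, hD]
  field_simp
  ring

theorem firmPayoff_update {θ : (Fin M → ℝ) × (Fin N → ℝ)} {j : Fin N}
    (hcap : (M : ℝ) * m.d₀ < (N : ℝ) * m.κ₀) (hb : 0 < totalBid θ - θ.2 j) {y : ℝ}
    (hy : -m.spareCapacity < y) :
    m.firmPayoff j (θ.1, Function.update θ.2 j
      ((totalBid θ - θ.2 j) * (m.κ₀ - y) / (m.spareCapacity + y))) =
      (totalBid θ - θ.2 j) * y / (m.spareCapacity + y) - m.C j y := by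
  set b := totalBid θ - θ.2 j with hb'
  have hR : 0 < (N : ℝ) * m.κ₀ - (M : ℝ) * m.d₀ := sub_pos.2 hcap
  have hy' : 0 < m.spareCapacity + y := by linarith
  have hp : m.price (θ.1, Function.update θ.2 j (b * (m.κ₀ - y) / (m.spareCapacity + y)))
      = b / (m.spareCapacity + y) := by
    rw [price_eq, totalBid_update_snd, ← hb', div_eq_div_iff hR.ne' hy'.ne', add_mul,
      div_mul_cancel₀ _ hy'.ne', spareCapacity_eq]
    ring
  have hS : m.supplyOffer (b * (m.κ₀ - y) / (m.spareCapacity + y)) (b / (m.spareCapacity + y))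
      = y := by
    rw [supplyOffer]
    field_simp
    ring
  simp only [firmPayoff, hp, Function.update_self, hS]
  field_simp
  ring

/-- Every bid is of the form considered in `consumerPayoff_update`. -/
theorem exists_demand_of_bid (hcap : (M : ℝ) * m.d₀ < (N : ℝ) * m.κ₀) {a t : ℝ} (ha : 0 < a)
    (ht : 0 ≤ t) :
    ∃ y, m.d₀ ≤ y ∧ y < m.maxDemand ∧ t = a * (y - m.d₀) / (m.maxDemand - y) := by
  have hR : 0 < (N : ℝ) * m.κ₀ - (M : ℝ) * m.d₀ := sub_pos.2 hcap
  set R := (N : ℝ) * m.κ₀ - (M : ℝ) * m.d₀ with hR'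
  have hK : m.maxDemand = R + m.d₀ := maxDemand_eq
  have hat : 0 < a + t := by linarith
  have h1 : m.maxDemand - (m.d₀ + t * R / (a + t)) = a * R / (a + t) := by
    rw [hK]; field_simp; ring
  have h2 : 0 < a * R / (a + t) := by positivity
  refine ⟨m.d₀ + t * R / (a + t), ?_, by linarith, ?_⟩
  · have : 0 ≤ t * R / (a + t) := by positivity
    linarith
  · rw [h1]; field_simp; ring

theorem exists_supply_of_bid (hcap : (M : ℝ) * m.d₀ < (N : ℝ) * m.κ₀) {b t : ℝ} (hb : 0 < b)
    (ht : 0 ≤ t) :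
    ∃ y, y ≤ m.κ₀ ∧ -m.spareCapacity < y ∧ t = b * (m.κ₀ - y) / (m.spareCapacity + y) := by
  have hR : 0 < (N : ℝ) * m.κ₀ - (M : ℝ) * m.d₀ := sub_pos.2 hcap
  set R := (N : ℝ) * m.κ₀ - (M : ℝ) * m.d₀ with hR'
  have hL : m.spareCapacity = R - m.κ₀ := spareCapacity_eq
  have hbt : 0 < b + t := by linarith
  have h1 : m.spareCapacity + (m.κ₀ - t * R / (b + t)) = b * R / (b + t) := by
    rw [hL]; field_simp; ring
  have h2 : 0 < b * R / (b + t) := by positivity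
  refine ⟨m.κ₀ - t * R / (b + t), ?_, by linarith, ?_⟩
  · have : 0 ≤ t * R / (b + t) := by positivity
    linarith
  · rw [h1]; field_simp; ring

section BestResponse

variable {θ : (Fin M → ℝ) × (Fin N → ℝ)}

/-- The bid of a consumer and the price in terms of the demand obtained and the other bids. -/
theorem bid_eq_of_demand (hcap : (M : ℝ) * m.d₀ < (N : ℝ) * m.κ₀) (i : Fin M)
    (hp : 0 < m.price θ) (ha : 0 < totalBid θ - θ.1 i) :
    (m.allocation θ).1 i < m.maxDemand ∧
    (totalBid θ - θ.1 i) / (m.maxDemand - (m.allocation θ).1 i) = m.price θ ∧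
    (totalBid θ - θ.1 i) * ((m.allocation θ).1 i - m.d₀) /
      (m.maxDemand - (m.allocation θ).1 i) = θ.1 i := by
  have hR : 0 < (N : ℝ) * m.κ₀ - (M : ℝ) * m.d₀ := sub_pos.2 hcap
  have hT : totalBid θ = m.price θ * ((N : ℝ) * m.κ₀ - (M : ℝ) * m.d₀) := by
    rw [price_eq, div_mul_cancel₀ _ hR.ne']
  have hx : (m.allocation θ).1 i = m.d₀ + θ.1 i / m.price θ := rfl
  have h1 : m.price θ * (m.maxDemand - (m.allocation θ).1 i) = totalBid θ - θ.1 i := by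
    rw [hx, hT, maxDemand_eq]; field_simp; ring
  have h2 : 0 < m.maxDemand - (m.allocation θ).1 i := by
    rw [← h1] at ha
    exact pos_of_mul_pos_right ha hp.le
  have h3 : (totalBid θ - θ.1 i) / (m.maxDemand - (m.allocation θ).1 i) = m.price θ := by
    rw [← h1, mul_div_cancel_right₀ _ h2.ne']
  refine ⟨sub_pos.1 h2, h3, ?_⟩
  rw [mul_div_right_comm, h3, hx]
  field_simp
  ring

theorem bid_eq_of_supply (hcap : (M : ℝ) * m.d₀ < (N : ℝ) * m.κ₀) (j : Fin N)
    (hp : 0 < m.price θ) (hb : 0 < totalBid θ - θ.2 j) :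
    -m.spareCapacity < (m.allocation θ).2 j ∧
    (totalBid θ - θ.2 j) / (m.spareCapacity + (m.allocation θ).2 j) = m.price θ ∧
    (totalBid θ - θ.2 j) * (m.κ₀ - (m.allocation θ).2 j) /
      (m.spareCapacity + (m.allocation θ).2 j) = θ.2 j := by
  have hR : 0 < (N : ℝ) * m.κ₀ - (M : ℝ) * m.d₀ := sub_pos.2 hcap
  have hT : totalBid θ = m.price θ * ((N : ℝ) * m.κ₀ - (M : ℝ) * m.d₀) := by
    rw [price_eq, div_mul_cancel₀ _ hR.ne']
  have hx : (m.allocation θ).2 j = m.κ₀ - θ.2 j / m.price θ := rfl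
  have h1 : m.price θ * (m.spareCapacity + (m.allocation θ).2 j) = totalBid θ - θ.2 j := by
    rw [hx, hT, spareCapacity_eq]; field_simp; ring
  have h2 : 0 < m.spareCapacity + (m.allocation θ).2 j := by
    rw [← h1] at hb
    exact pos_of_mul_pos_right hb hp.le
  have h3 : (totalBid θ - θ.2 j) / (m.spareCapacity + (m.allocation θ).2 j) = m.price θ := by
    rw [← h1, mul_div_cancel_right₀ _ h2.ne']
  refine ⟨by linarith, h3, ?_⟩
  rw [mul_div_right_comm, h3, hx]
  field_simp
  ring

theorem consumer_best_iff (h1 : m.ConcaveUtilitiesConvexCosts) (hd₀ : 0 < m.d₀)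
    (hcap : (M : ℝ) * m.d₀ < (N : ℝ) * m.κ₀) (i : Fin M) (hθ : 0 ≤ θ.1 i)
    (hp : 0 < m.price θ) (ha : 0 < totalBid θ - θ.1 i) :
    (∀ t : ℝ, 0 ≤ t →
      m.consumerPayoff i (Function.update θ.1 i t, θ.2) ≤ m.consumerPayoff i θ) ↔
    ∀ y, m.d₀ ≤ y → ((1 - (m.allocation θ).1 i / m.maxDemand) *
      m.marginalUtility i ((m.allocation θ).1 i) - m.price θ) *
        (y - (m.allocation θ).1 i) ≤ 0 := by
  obtain ⟨hxK, hprice, hbid⟩ := bid_eq_of_demand hcap i hp ha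
  have hxd : m.d₀ ≤ (m.allocation θ).1 i := le_add_of_nonneg_right (div_nonneg hθ hp.le)
  set x := (m.allocation θ).1 i with hx
  have hK := d₀_lt_maxDemand hcap
  have hpay : m.consumerPayoff i θ = m.U i x - (totalBid θ - θ.1 i) * x / (m.maxDemand - x) := by
    rw [← consumerPayoff_update hcap ha hxK, hbid, Function.update_eq_self]
  have hiff := isMaxOn_sub_mul_div_iff (K := m.maxDemand)
    ((h1.utility_concave i).subset (Set.Ico_subset_Ici_self : Set.Ico m.d₀ m.maxDemand ⊆ _)
      (convex_Ico _ _))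
    ((h1.hasDerivWithinAt_U i hxd).mono Set.Ico_subset_Ici_self) ⟨hxd, hxK⟩ ha
    (fun y hy => mul_pos (hd₀.trans hK) (sub_pos.2 hy.2))
  rw [hprice] at hiff
  have hleft : (∀ t : ℝ, 0 ≤ t →
      m.consumerPayoff i (Function.update θ.1 i t, θ.2) ≤ m.consumerPayoff i θ) ↔
      IsMaxOn (fun y => m.U i y - (totalBid θ - θ.1 i) * y / (m.maxDemand - y))
        (Set.Ico m.d₀ m.maxDemand) x := by
    constructor
    · intro h y hy
      have := h _ (div_nonneg (mul_nonneg ha.le (sub_nonneg.2 hy.1)) (sub_pos.2 hy.2).le)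
      rwa [consumerPayoff_update hcap ha hy.2, hpay] at this
    · intro h t ht
      obtain ⟨y, hy1, hy2, rfl⟩ := exists_demand_of_bid hcap ha ht
      rw [consumerPayoff_update hcap ha hy2, hpay]
      exact h ⟨hy1, hy2⟩
  rw [hleft, hiff]
  refine ⟨fun h y hy => ?_, fun h y hy => h y hy.1⟩
  rcases lt_or_ge y m.maxDemand with hyK | hyK
  · exact h y ⟨hy, hyK⟩
  · have := h ((x + m.maxDemand) / 2) ⟨by linarith, by linarith⟩
    nlinarith

theorem firm_best_iff (h1 : m.ConcaveUtilitiesConvexCosts) (hκ₀ : 0 < m.κ₀)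
    (hL : 0 < m.spareCapacity)
    (hcap : (M : ℝ) * m.d₀ < (N : ℝ) * m.κ₀) (j : Fin N) (hθ : 0 ≤ θ.2 j)
    (hp : 0 < m.price θ) (hb : 0 < totalBid θ - θ.2 j) :
    (∀ t : ℝ, 0 ≤ t →
      m.firmPayoff j (θ.1, Function.update θ.2 j t) ≤ m.firmPayoff j θ) ↔
    0 ≤ (m.allocation θ).2 j ∧
    ∀ y, 0 ≤ y → y ≤ m.κ₀ → (m.price θ - (1 + (m.allocation θ).2 j / m.spareCapacity) *
      m.marginalCost j ((m.allocation θ).2 j)) * (y - (m.allocation θ).2 j) ≤ 0 := by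
  obtain ⟨hxL, hprice, hbid⟩ := bid_eq_of_supply hcap j hp hb
  have hxκ : (m.allocation θ).2 j ≤ m.κ₀ := sub_le_self _ (div_nonneg hθ hp.le)
  set x := (m.allocation θ).2 j with hx
  have hpay : m.firmPayoff j θ =
      (totalBid θ - θ.2 j) * x / (m.spareCapacity + x) - m.C j x := by
    rw [← firmPayoff_update hcap hb hxL, hbid, Function.update_eq_self]
  have hneg : ∀ y, y < 0 → -m.spareCapacity < y →
      (totalBid θ - θ.2 j) * y / (m.spareCapacity + y) - m.C j y < 0 := fun y hy hy' => by
    rw [h1.cost_nonpos j y hy.le, sub_zero]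
    exact div_neg_of_neg_of_pos (mul_neg_of_pos_of_neg hb hy) (by linarith)
  have hzero : (totalBid θ - θ.2 j) * 0 / (m.spareCapacity + 0) - m.C j 0 = 0 := by
    simp [h1.cost_nonpos j 0 le_rfl]
  have hleft : (∀ t : ℝ, 0 ≤ t →
      m.firmPayoff j (θ.1, Function.update θ.2 j t) ≤ m.firmPayoff j θ) ↔
      0 ≤ x ∧ ∀ y ∈ Set.Icc 0 m.κ₀, (totalBid θ - θ.2 j) * y / (m.spareCapacity + y) - m.C j y
        ≤ (totalBid θ - θ.2 j) * x / (m.spareCapacity + x) - m.C j x := by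
    constructor
    · intro h
      have h' : ∀ y ∈ Set.Icc 0 m.κ₀,
          (totalBid θ - θ.2 j) * y / (m.spareCapacity + y) - m.C j y
            ≤ (totalBid θ - θ.2 j) * x / (m.spareCapacity + x) - m.C j x := by
        intro y hy
        have := h _ (div_nonneg (mul_nonneg hb.le (sub_nonneg.2 hy.2))
          (by linarith [hy.1] : 0 ≤ m.spareCapacity + y))
        rwa [firmPayoff_update hcap hb (by linarith [hy.1]), hpay] at this
      refine ⟨?_, h'⟩
      by_contra! hx0
      have h2 := h' 0 ⟨le_rfl, hκ₀.le⟩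
      rw [hzero] at h2
      exact absurd (hneg x hx0 hxL) (not_lt.2 h2)
    · rintro ⟨-, h⟩ t ht
      obtain ⟨y, hy1, hy2, rfl⟩ := exists_supply_of_bid hcap hb ht
      rw [firmPayoff_update hcap hb hy2, hpay]
      rcases lt_or_ge y 0 with hy | hy
      · have h2 := h 0 ⟨le_rfl, hκ₀.le⟩
        rw [hzero] at h2
        exact (hneg y hy hy2).le.trans h2
      · exact h y ⟨hy, hy1⟩
  rw [hleft]
  refine and_congr_right fun hx0 => ?_
  have hiff := isMaxOn_sub_mul_div_iff (K := -m.spareCapacity)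
    ((h1.cost_convex j).neg.subset (Set.Icc_subset_Ici_self : Set.Icc 0 m.κ₀ ⊆ _) (convex_Icc _ _))
    ((h1.hasDerivWithinAt_C j hx0).neg.mono Set.Icc_subset_Ici_self) ⟨hx0, hxκ⟩ hb
    (fun y hy => mul_pos_of_neg_of_neg (neg_lt_zero.2 hL) (by linarith [hy.1]))
  have hflip : ∀ y c : ℝ, c / (-m.spareCapacity - y) = -(c / (m.spareCapacity + y)) := by
    intro y c
    rw [← neg_add', div_neg]
  simp only [hflip, hprice, div_neg, sub_neg_eq_add, isMaxOn_iff, Pi.neg_apply] at hiff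
  constructor
  · intro h y hy0 hy1
    have := hiff.1 (fun y hy => by linarith [h y hy]) y ⟨hy0, hy1⟩
    linarith
  · intro h y hy
    have := hiff.2 (fun y hy => by linarith [h y hy.1 hy.2]) y hy
    linarith

end BestResponse

variable {θ : (Fin M → ℝ) × (Fin N → ℝ)}

theorem IsNashEquilibrium.otherBids_pos_consumer (h : m.IsNashEquilibrium θ)
    (h1 : m.ConcaveUtilitiesConvexCosts) (hd₀ : 0 < m.d₀)
    (hcap : (M : ℝ) * m.d₀ < (N : ℝ) * m.κ₀) (i : Fin M) : 0 < totalBid θ - θ.1 i := by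
  have hR : 0 < (N : ℝ) * m.κ₀ - (M : ℝ) * m.d₀ := sub_pos.2 hcap
  by_contra! hneg
  have hle : θ.1 i ≤ ∑ k, θ.1 k :=
    Finset.single_le_sum (f := θ.1) (fun k _ => h.consumer_nonneg k) (Finset.mem_univ i)
  have hnn : 0 ≤ ∑ j, θ.2 j := Finset.sum_nonneg fun j _ => h.firm_nonneg j
  have hzero : totalBid θ - θ.1 i = 0 := by
    simp only [totalBid] at hneg ⊢
    linarith
  have hpay : ∀ t, 0 < t → m.consumerPayoff i (Function.update θ.1 i t, θ.2) =
      m.U i m.maxDemand - t * (1 + m.d₀ / ((N : ℝ) * m.κ₀ - (M : ℝ) * m.d₀)) := by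
    intro t ht
    have hD : m.demandBid t (t / ((N : ℝ) * m.κ₀ - (M : ℝ) * m.d₀)) = m.maxDemand := by
      rw [demandBid, maxDemand_eq, div_div_cancel₀ ht.ne', add_comm]
    simp only [consumerPayoff, price_eq, totalBid_update_fst, hzero, zero_add,
      Function.update_self, hD]
    ring
  have hc : 0 < 1 + m.d₀ / ((N : ℝ) * m.κ₀ - (M : ℝ) * m.d₀) := by positivity
  rcases (h.consumer_nonneg i).eq_or_lt with h0 | h0
  · have hθ : m.consumerPayoff i θ = 0 := by
      have hT : totalBid θ = 0 := by linarith
      simp [consumerPayoff, price_eq, hT, ← h0, demandBid, h1.utility_d₀ i]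
    have hU : 0 < m.U i m.maxDemand := by
      have hK := d₀_lt_maxDemand hcap
      have := h1.utility_strictMono i Set.self_mem_Ici hK.le hK
      rwa [h1.utility_d₀ i] at this
    set c := 1 + m.d₀ / ((N : ℝ) * m.κ₀ - (M : ℝ) * m.d₀) with hc'
    have ht : 0 < m.U i m.maxDemand / (2 * c) := by positivity
    have h2 := h.consumer_best i _ ht.le
    rw [hpay _ ht, hθ] at h2
    have h3 : m.U i m.maxDemand / (2 * c) * c = m.U i m.maxDemand / 2 := by
      field_simp
    linarith
  · have h2 := h.consumer_best i (θ.1 i / 2) (by linarith)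
    have h3 := hpay (θ.1 i) h0
    rw [Function.update_eq_self] at h3
    rw [hpay _ (half_pos h0), h3] at h2
    nlinarith

theorem IsNashEquilibrium.price_pos (h : m.IsNashEquilibrium θ)
    (h1 : m.ConcaveUtilitiesConvexCosts) (hM : 0 < M) (hd₀ : 0 < m.d₀)
    (hcap : (M : ℝ) * m.d₀ < (N : ℝ) * m.κ₀) : 0 < m.price θ := by
  have h2 := h.otherBids_pos_consumer h1 hd₀ hcap ⟨0, hM⟩
  have h3 : 0 < totalBid θ := by linarith [h.consumer_nonneg ⟨0, hM⟩]
  exact div_pos h3 (sub_pos.2 hcap)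

theorem IsNashEquilibrium.otherBids_pos_firm (h : m.IsNashEquilibrium θ)
    (h1 : m.ConcaveUtilitiesConvexCosts) (hM : 0 < M) (hd₀ : 0 < m.d₀)
    (hcap : (M : ℝ) * m.d₀ < (N : ℝ) * m.κ₀) (hL : 0 < m.spareCapacity) (j : Fin N) :
    0 < totalBid θ - θ.2 j := by
  have hR : 0 < (N : ℝ) * m.κ₀ - (M : ℝ) * m.d₀ := sub_pos.2 hcap
  by_contra! hneg
  have hle : θ.2 j ≤ ∑ k, θ.2 k :=
    Finset.single_le_sum (f := θ.2) (fun k _ => h.firm_nonneg k) (Finset.mem_univ j)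
  have hnn : 0 ≤ ∑ i, θ.1 i := Finset.sum_nonneg fun i _ => h.consumer_nonneg i
  have hzero : totalBid θ - θ.2 j = 0 := by
    simp only [totalBid] at hneg ⊢
    linarith
  have hpay : ∀ t, 0 < t → m.firmPayoff j (θ.1, Function.update θ.2 j t) =
      -(t * (m.spareCapacity / ((N : ℝ) * m.κ₀ - (M : ℝ) * m.d₀))) := by
    intro t ht
    have hS : m.supplyOffer t (t / ((N : ℝ) * m.κ₀ - (M : ℝ) * m.d₀)) = -m.spareCapacity := by
      rw [supplyOffer, spareCapacity_eq, div_div_cancel₀ ht.ne', neg_sub]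
    simp only [firmPayoff, price_eq, totalBid_update_snd, hzero, zero_add,
      Function.update_self, hS, h1.cost_nonpos j _ (neg_nonpos.2 hL.le)]
    rw [spareCapacity_eq]
    field_simp
    ring
  have hc : 0 < m.spareCapacity / ((N : ℝ) * m.κ₀ - (M : ℝ) * m.d₀) := by positivity
  have hT : 0 < totalBid θ := by
    have hp := h.price_pos h1 hM hd₀ hcap
    rw [price_eq, div_pos_iff_of_pos_right hR] at hp
    exact hp
  have h0 : 0 < θ.2 j := by linarith
  have h2 := h.firm_best j (θ.2 j / 2) (by linarith)
  have h3 := hpay (θ.2 j) h0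
  rw [Function.update_eq_self] at h3
  rw [hpay _ (half_pos h0), h3] at h2
  nlinarith

theorem IsNashEquilibrium.isSupportedBy (h : m.IsNashEquilibrium θ)
    (h1 : m.ConcaveUtilitiesConvexCosts) (hM : 0 < M) (hd₀ : 0 < m.d₀) (hκ₀ : 0 < m.κ₀)
    (hcap : (M : ℝ) * m.d₀ < (N : ℝ) * m.κ₀) (hL : 0 < m.spareCapacity) :
    m.IsSupportedBy (m.allocation θ) (m.price θ) := by
  have hp := h.price_pos h1 hM hd₀ hcap
  have hR : 0 < (N : ℝ) * m.κ₀ - (M : ℝ) * m.d₀ := sub_pos.2 hcap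
  have hcons := fun i => (consumer_best_iff h1 hd₀ hcap i (h.consumer_nonneg i) hp
    (h.otherBids_pos_consumer h1 hd₀ hcap i)).1 (h.consumer_best i)
  have hfirm := fun j => (firm_best_iff h1 hκ₀ hL hcap j (h.firm_nonneg j) hp
    (h.otherBids_pos_firm h1 hM hd₀ hcap hL j)).1 (h.firm_best j)
  refine ⟨⟨?_, fun j => ⟨(hfirm j).1, sub_le_self _ (div_nonneg (h.firm_nonneg j) hp.le)⟩,
    fun i => le_add_of_nonneg_right (div_nonneg (h.consumer_nonneg i) hp.le)⟩, hcons,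
    fun j => (hfirm j).2⟩
  have hT : (∑ i, θ.1 i + ∑ j, θ.2 j) / m.price θ = (N : ℝ) * m.κ₀ - (M : ℝ) * m.d₀ := by
    rw [div_eq_iff hp.ne', price, mul_div_cancel₀ _ hR.ne']
  simp only [allocation, demandBid, supplyOffer, Finset.sum_add_distrib, Finset.sum_sub_distrib,
    ← Finset.sum_div, Finset.sum_const, Finset.card_univ, Fintype.card_fin, nsmul_eq_mul]
  rw [add_div] at hT
  linarith

/-- The bids that lead to the allocation `x` at the price `p`. -/
def bids (m : Market M N) (x : (Fin M → ℝ) × (Fin N → ℝ)) (p : ℝ) :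
    (Fin M → ℝ) × (Fin N → ℝ) :=
  (fun i => p * (x.1 i - m.d₀), fun j => p * (m.κ₀ - x.2 j))

theorem bids_allocation_price (hp : m.price θ ≠ 0) :
    m.bids (m.allocation θ) (m.price θ) = θ := by
  refine Prod.ext (funext fun i => ?_) (funext fun j => ?_)
  · simp only [bids, allocation, demandBid]
    field_simp
    ring
  · simp only [bids, allocation, supplyOffer]
    field_simp
    ring

theorem totalBid_bids {x : (Fin M → ℝ) × (Fin N → ℝ)} (hx : x ∈ m.feasible) (p : ℝ) :
    totalBid (m.bids x p) = p * ((N : ℝ) * m.κ₀ - (M : ℝ) * m.d₀) := by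
  simp only [totalBid, bids, ← Finset.mul_sum, Finset.sum_sub_distrib, hx.1, Finset.sum_const,
    Finset.card_univ, Fintype.card_fin, nsmul_eq_mul]
  ring

theorem price_bids {x : (Fin M → ℝ) × (Fin N → ℝ)} (hx : x ∈ m.feasible) (p : ℝ)
    (hcap : (M : ℝ) * m.d₀ < (N : ℝ) * m.κ₀) : m.price (m.bids x p) = p := by
  rw [price_eq, totalBid_bids hx, mul_div_cancel_right₀ _ (sub_pos.2 hcap).ne']

theorem allocation_bids {x : (Fin M → ℝ) × (Fin N → ℝ)} (hx : x ∈ m.feasible) {p : ℝ}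
    (hp : p ≠ 0) (hcap : (M : ℝ) * m.d₀ < (N : ℝ) * m.κ₀) :
    m.allocation (m.bids x p) = x := by
  rw [allocation, price_bids hx p hcap]
  refine Prod.ext (funext fun i => ?_) (funext fun j => ?_)
  · simp [bids, demandBid, mul_div_cancel_left₀ _ hp]
  · simp [bids, supplyOffer, mul_div_cancel_left₀ _ hp]

theorem IsSupportedBy.isNashEquilibrium {x : (Fin M → ℝ) × (Fin N → ℝ)} {p : ℝ}
    (h : m.IsSupportedBy x p) (h1 : m.ConcaveUtilitiesConvexCosts) (hM : 0 < M)
    (hd₀ : 0 < m.d₀) (hκ₀ : 0 < m.κ₀)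
    (hcap : (M : ℝ) * m.d₀ < (N : ℝ) * m.κ₀) (hL : 0 < m.spareCapacity) :
    m.IsNashEquilibrium (m.bids x p) := by
  have hp := h.price_pos h1 hM hd₀ hL
  have hx := h.feasible
  have hprice := price_bids hx p hcap
  have halloc := allocation_bids hx hp.ne' hcap
  have hT := totalBid_bids hx p
  have hc : ∀ i, 0 ≤ (m.bids x p).1 i := fun i => mul_nonneg hp.le (sub_nonneg.2 (hx.2.2 i))
  have hf : ∀ j, 0 ≤ (m.bids x p).2 j := fun j => mul_nonneg hp.le (sub_nonneg.2 (hx.2.1 j).2)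
  refine ⟨hc, hf, fun i => ?_, fun j => ?_⟩
  · have ha : 0 < totalBid (m.bids x p) - (m.bids x p).1 i := by
      have h2 := mul_pos hp (sub_pos.2 (h.demand_lt_maxDemand hp hd₀ hcap i))
      rw [hT]
      simp only [bids]
      rw [maxDemand_eq] at h2
      linarith
    rw [consumer_best_iff h1 hd₀ hcap i (hc i) (by rwa [hprice]) ha, hprice, halloc]
    exact h.consumer i
  · have hb : 0 < totalBid (m.bids x p) - (m.bids x p).2 j := by
      have h2 : 0 < p * (m.spareCapacity + x.2 j) :=
        mul_pos hp (by linarith [(hx.2.1 j).1])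
      rw [hT]
      simp only [bids]
      rw [spareCapacity_eq] at h2
      linarith
    rw [firm_best_iff h1 hκ₀ hL hcap j (hf j) (by rwa [hprice]) hb, hprice, halloc]
    exact ⟨(hx.2.1 j).1, h.firm j⟩

end Market


theorem theorem2 {M N : ℕ} (m : Market M N) (hM : 0 < M) (hd₀ : 0 < m.d₀) (hκ₀ : 0 < m.κ₀)
    (hcap : (M : ℝ) * m.d₀ < (N : ℝ) * m.κ₀)
    (h1 : m.ConcaveUtilitiesConvexCosts) (h2 : m.NoPivotalSupplier) :
    -- a Nash equilibrium exists, and it is unique if the costs (which vanish on `(-∞, 0]`) are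
    -- continuously differentiable on the whole line, or if the inelastic demand is not a
    -- multiple of the capacity
    (∃ θ, m.IsNashEquilibrium θ) ∧
    (((∀ j, ContDiff ℝ 1 (m.C j)) ∨ (∀ k : ℕ, (M : ℝ) * m.d₀ ≠ (k : ℝ) * m.κ₀)) →
      ∃! θ, m.IsNashEquilibrium θ) ∧
    -- the program is convex, has exactly one solution, and this is the allocation at every
    -- Nash equilibrium
    ConcaveOn ℝ m.feasible m.modifiedWelfare ∧
    (∃! x, m.SolvesModifiedProgram x) ∧
    (∀ θ, m.IsNashEquilibrium θ →
      0 < m.price θ ∧ m.SolvesModifiedProgram (m.allocation θ)) := by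
  have hL := Market.spareCapacity_pos hM hd₀ hcap h2
  have hsol := Market.existsUnique_solvesModifiedProgram hd₀ hcap h1 hL
  obtain ⟨x, hx, hxu⟩ := hsol
  obtain ⟨p, hp⟩ := hx.exists_isSupportedBy hM h1
  have hNE := hp.isNashEquilibrium h1 hM hd₀ hκ₀ hcap hL
  have hsupp := fun θ (hθ : m.IsNashEquilibrium θ) => hθ.isSupportedBy h1 hM hd₀ hκ₀ hcap hL
  have hpos := fun θ (hθ : m.IsNashEquilibrium θ) => hθ.price_pos h1 hM hd₀ hcap
  have hsolves := fun θ (hθ : m.IsNashEquilibrium θ) =>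
    (hsupp θ hθ).solvesModifiedProgram h1 hd₀ hL
  refine ⟨⟨_, hNE⟩, fun hC => ⟨_, hNE, fun θ hθ => ?_⟩,
    (Market.strictConcaveOn_modifiedWelfare h1 hd₀ hL).concaveOn, ⟨x, hx, hxu⟩,
    fun θ hθ => ⟨hpos θ hθ, hsolves θ hθ⟩⟩
  have hx' : m.allocation θ = x := hxu _ (hsolves θ hθ)
  have hs := hsupp θ hθ
  rw [hx'] at hs
  have hpq : m.price θ = p := hs.price_unique hp h1 hM hd₀ hκ₀ hL hcap hC
  rw [← Market.bids_allocation_price (hpos θ hθ).ne', hx', hpq]
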